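/- For a finite simple graph $H$ and an integer $s\ge 1$, write $G\to(H)_s$ if every colouring of the edges of the graph $G$ with $s$ colours contains a monochromatic copy of $H$ (as a not necessarily induced subgraph), and let $\hat r_s(H)=\min\{|E(G)| : G \text{ a finite graph with } G\to (H)_s\}$ be the $s$-colour size-Ramsey number of $H$. For $n\ge 3$ let $C_n$ be the cycle on $n$ vertices, and for $k\ge 1$ let $C_n^k$ be its $k$-th power, i.e. the graph on $V(C_n)$ in which two distinct vertices are adjacent if and only if their distance in $C_n$ is at most $k$. Then for all integers $s\ge 1$ and $k\ge 1$ we have $\hat r_s(C_n^k)=O(n)$; that is, there is a constant $C=C(s,k)$ such that $\hat r_s(C_n^k)\le Cn$ for every $n\ge 3$. -/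

import Mathlib

/-- The `k`-th power of a graph `H`: distinct vertices are adjacent if and only if their distance
in `H` is at most `k` (vertices in different components are at distance `⊤`). -/
def graphPower {V : Type*} (H : SimpleGraph V) (k : ℕ) : SimpleGraph V where
  Adj u v := u ≠ v ∧ H.edist u v ≤ (k : ℕ∞)
  symm := ⟨fun _ _ h => ⟨h.1.symm, by rw [SimpleGraph.edist_comm]; exact h.2⟩⟩
  loopless := ⟨fun _ h => h.1 rfl⟩

/-- `G → (H)_s`: every colouring of the edges of `G` with `s` colours contains a monochromatic
copy of `H` (as a not necessarily induced subgraph). -/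
def IsRamseyFor {W V : Type*} (s : ℕ) (G : SimpleGraph W) (H : SimpleGraph V) : Prop :=
  ∀ χ : G.EdgeLabeling (Fin s), ∃ c : Fin s, H.IsContained (χ.labelGraph c)

/-- The `s`-colour size-Ramsey number of a finite graph `H`: the least number of edges of a finite
graph `G` with `G → (H)_s`. The value lies in `ℕ∞`; it would be `⊤` if there were no such `G`. -/
noncomputable def sizeRamsey {V : Type*} (s : ℕ) (H : SimpleGraph V) : ℕ∞ :=
  ⨅ (N : ℕ) (G : SimpleGraph (Fin N)) (_ : IsRamseyFor s G H), G.edgeSet.encard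

/-! The host graph is the power `graphPower F R`, `R = 2 * (s + 1)`, of a bounded-degree graph `F`
on `C * n` vertices with an edge between any two disjoint sets of size `n`
(`exists_bounded_degree_expander`). For fixed `s` and `k` it has `O(n)` edges. It suffices to find a
monochromatic thick path with blocks of size `2 * k`: folding the cycle flat embeds `C_n^k` in it
(`HasThickPath.cycle_power_isContained`).

Suppose no colour has a thick path. By induction on `ℓ` one builds linearly many disjoint boxes
`[M]^ℓ` of vertices whose lines in the `ℓ` directions are monochromatic in `ℓ` distinct colours.
Dimension `s + 1` is absurd, there being only `s` colours.

For the step (`ClusterSystem.exists_succ`), call two nearby boxes linked in `γ` if large sub-boxes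
of them are joined entirely in `γ` and `γ` is a line colour of both. A long path of linked boxes is
a thick path: take a `γ`-line in each box. So such paths are short, and a depth-first search
(`exists_unrelated_subsets`) yields large families without linked pairs. Matchings in `F` attach
many boxes to a common vertex. Ramsey's theorem and its product version find, among them, sub-boxes
with the same line colours, joined pairwise in a single colour. Being unlinked makes that colour
new, so these sub-boxes stack up into a box of dimension `ℓ + 1`. -/

/-! ### Ramsey's theorem for pairs and for boxes. -/

/-- The least element of `S` keeps only its most popular colour class, in which the argument
repeats; the colour of a pair then depends on its smaller element alone. -/
theorem exists_prehomogeneous_subset (κ : Type) [Fintype κ] (M : ℕ) :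
    ∃ L : ℕ, ∀ (h : ℕ → ℕ → κ) (S : Finset ℕ), L ≤ S.card →
      ∃ T ⊆ S, T.card = M ∧ ∃ f : ℕ → κ, ∀ i ∈ T, ∀ j ∈ T, i < j → h i j = f i := by
  classical
  induction M with
  | zero =>
    -- The bound is 1 and not 0 because a point of `S` is needed to produce an element of `κ`, and
    -- hence `f`.
    refine ⟨1, fun h S hS => ⟨∅, by simp, rfl, ?_⟩⟩
    obtain ⟨a, -⟩ := Finset.card_pos.mp hS
    exact ⟨fun i => h i a, by simp⟩
  | succ M ih =>
    obtain ⟨L, hL⟩ := ih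
    refine ⟨1 + Fintype.card κ * L, fun h S hS => ?_⟩
    have hne : S.Nonempty := Finset.card_pos.mp (by omega)
    set a := S.min' hne with ha
    have haS : a ∈ S := S.min'_mem hne
    have hcard : (Finset.univ : Finset κ).card * L ≤ (S.erase a).card := by
      rw [Finset.card_erase_of_mem haS, Finset.card_univ]; omega
    have hκ : (Finset.univ : Finset κ).Nonempty := ⟨h a a, Finset.mem_univ _⟩
    obtain ⟨c, -, hc⟩ := Finset.exists_le_card_fiber_of_mul_le_card_of_maps_to
      (f := h a) (fun _ _ => Finset.mem_univ _) hκ hcard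
    obtain ⟨T, hTS, hTM, f, hf⟩ := hL h _ hc
    have hT : ∀ i ∈ T, i ∈ S ∧ i ≠ a ∧ h a i = c := fun i hi => by
      have := hTS hi
      simp only [Finset.mem_filter, Finset.mem_erase] at this
      exact ⟨this.1.2, this.1.1, this.2⟩
    have haT : a ∉ T := fun h' => (hT a h').2.1 rfl
    refine ⟨insert a T, Finset.insert_subset haS fun i hi => (hT i hi).1,
      by rw [Finset.card_insert_of_notMem haT, hTM], Function.update f a c, ?_⟩
    intro i hi j hj hij
    rcases Finset.mem_insert.mp hi with rfl | hi
    · rcases Finset.mem_insert.mp hj with rfl | hj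
      · exact absurd hij (lt_irrefl _)
      · simpa using (hT j hj).2.2
    · rw [Function.update_of_ne (hT i hi).2.1]
      rcases Finset.mem_insert.mp hj with rfl | hj
      · exact absurd hij (not_lt.mpr (S.min'_le i (hT i hi).1))
      · exact hf i hi j hj hij

/-- Ramsey's theorem for pairs, with finitely many colours. -/
theorem exists_homogeneous_strictMono (κ : Type) [Fintype κ] (M : ℕ) :
    ∃ L : ℕ, ∀ h : Fin L → Fin L → κ,
      ∃ (e : Fin M → Fin L) (γ : κ), StrictMono e ∧ ∀ i j, i < j → h (e i) (e j) = γ := by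
  classical
  obtain ⟨L, hL⟩ := exists_prehomogeneous_subset κ (Fintype.card κ * M)
  refine ⟨L + 1, fun h => ?_⟩
  obtain ⟨T, hTS, hTM, f, hf⟩ := hL (fun i j => h (Fin.ofNat _ i) (Fin.ofNat _ j))
    (Finset.range (L + 1)) (by simp)
  obtain ⟨γ, -, hγ⟩ := Finset.exists_le_card_fiber_of_mul_le_card_of_maps_to (s := T)
    (t := (Finset.univ : Finset κ)) (n := M) (f := f) (fun _ _ => Finset.mem_univ _)
    ⟨h 0 0, Finset.mem_univ _⟩ (by rw [hTM, Finset.card_univ])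
  obtain ⟨U, hUT, hU⟩ := Finset.exists_subset_card_eq hγ
  have hmem : ∀ i, U.orderEmbOfFin hU i ∈ T ∧ f (U.orderEmbOfFin hU i) = γ := fun i =>
    Finset.mem_filter.mp (hUT (U.orderEmbOfFin_mem hU i))
  have hlt : ∀ i, U.orderEmbOfFin hU i < L + 1 := fun i =>
    Finset.mem_range.mp (hTS (hmem i).1)
  refine ⟨fun i => ⟨U.orderEmbOfFin hU i, hlt i⟩, γ,
    fun i j hij => (U.orderEmbOfFin hU).strictMono hij, fun i j hij => ?_⟩
  have := hf _ (hmem i).1 _ (hmem j).1 ((U.orderEmbOfFin hU).strictMono hij)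
  rw [(hmem i).2] at this
  rw [← this]
  congr 1 <;> ext <;> simp [Nat.mod_eq_of_lt (hlt _)]

/-- The product Ramsey theorem: a finitely coloured large box contains a large monochromatic
sub-box. -/
theorem exists_monochromatic_box (δ : Type) [Finite δ] (κ : Type) [Fintype κ] (m : ℕ) :
    ∃ M₀ : ℕ, ∀ M, M₀ ≤ M → ∀ Φ : (δ → Fin M) → κ,
      ∃ (e : δ → (Fin m ↪ Fin M)) (γ : κ), ∀ y : δ → Fin m, Φ (fun d => e d (y d)) = γ := by
  classical
  induction δ using Finite.induction_empty_option with
  | of_equiv σ ih =>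
    obtain ⟨M₀, hM₀⟩ := ih
    refine ⟨M₀, fun M hM Φ => ?_⟩
    obtain ⟨e, γ, h⟩ := hM₀ M hM (fun x => Φ (fun d => x (σ.symm d)))
    refine ⟨fun d => e (σ.symm d), γ, fun y => ?_⟩
    simpa using h (fun d => y (σ d))
  | h_empty => exact ⟨m, fun M hM Φ => ⟨nofun, Φ nofun, fun y => congrArg Φ (Subsingleton.elim _ _)⟩⟩
  | @h_option δ _ ih =>
    obtain ⟨M₁, hM₁⟩ := ih
    have := Fintype.ofFinite δ
    -- The old coordinates are confined to their first `M₁` values, so the number of pairs (sub-box,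
    -- colour) in the pigeonhole over the new coordinate does not depend on `M`.
    refine ⟨max M₁ (1 + Fintype.card ((δ → (Fin m ↪ Fin M₁)) × κ) * m), fun M hM Φ => ?_⟩
    have h₁ : M₁ ≤ M := (le_max_left _ _).trans hM
    have h₂ : 1 + Fintype.card ((δ → (Fin m ↪ Fin M₁)) × κ) * m ≤ M := (le_max_right _ _).trans hM
    have key : ∀ a : Fin M, ∃ p : (δ → (Fin m ↪ Fin M₁)) × κ, ∀ y : δ → Fin m,
        Φ (fun d => d.elim a fun d => Fin.castLE h₁ (p.1 d (y d))) = p.2 := fun a => by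
      obtain ⟨e, γ, h⟩ := hM₁ M₁ le_rfl
        (fun x => Φ (fun d => d.elim a fun d => Fin.castLE h₁ (x d)))
      exact ⟨(e, γ), h⟩
    choose p hp using key
    obtain ⟨⟨e, γ⟩, -, hγ⟩ := Finset.exists_le_card_fiber_of_mul_le_card_of_maps_to
      (s := (Finset.univ : Finset (Fin M))) (n := m) (f := p) (fun _ _ => Finset.mem_univ _)
      ⟨p ⟨0, by omega⟩, Finset.mem_univ _⟩ (by rw [Finset.card_univ, Finset.card_fin]; omega)
    obtain ⟨U, hU, hUm⟩ := Finset.exists_subset_card_eq hγ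
    have hmem : ∀ i, p (U.orderEmbOfFin hUm i) = (e, γ) := fun i =>
      (Finset.mem_filter.mp (hU (U.orderEmbOfFin_mem hUm i))).2
    refine ⟨fun d => d.elim (U.orderEmbOfFin hUm).toEmbedding
      fun d => (e d).trans (Fin.castLEEmb h₁), γ, fun y => ?_⟩
    have := hp (U.orderEmbOfFin hUm (y none)) (fun d => y (some d))
    rw [hmem] at this
    refine Eq.trans (congrArg Φ (funext fun d => ?_)) this
    cases d <;> rfl

/-! ### Sparse pairs from the absence of long paths; matchings. -/

/-- In a symmetric relation with no long path, any two large disjoint sets contain large subsets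
with no relation between them. -/
theorem exists_unrelated_subsets {V : Type} [DecidableEq V] (E : V → V → Prop)
    (hsymm : ∀ v w, E v w → E w v) (X Y : Finset V)
    (n q : ℕ) (hX : 2 * q + n ≤ X.card) (hY : 2 * q + n ≤ Y.card)
    (hE : ∀ l : List V, l.Nodup → l.IsChain E → l.length < n) :
    ∃ A ⊆ X, ∃ B ⊆ Y, q ≤ A.card ∧ q ≤ B.card ∧ ∀ a ∈ A, ∀ b ∈ B, ¬ E a b := by
  classical
  by_contra! hno
  -- Depth-first search: `l` is the current path and `D` the set of finished vertices, unrelated to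
  -- all unvisited ones. A push or a pop raises `2 * D.card + l.length` by one. If `D` ever held `q`
  -- elements of `X` or of `Y`, these and the unvisited part of the other set would be the desired
  -- pair; so the search never stops, although the potential is bounded.
  have key : ∀ k : ℕ, ∃ (D : Finset V) (l : List V), D ⊆ X ∪ Y ∧ l.Nodup ∧ l.IsChain E ∧
      (∀ v ∈ l, v ∉ D) ∧ (∀ d ∈ D, ∀ u ∈ X ∪ Y, u ∉ D → u ∉ l → ¬ E d u) ∧
      (D ∩ X).card ≤ q ∧ (D ∩ Y).card ≤ q ∧ (∀ v ∈ l, v ∈ X ∪ Y) ∧ k ≤ 2 * D.card + l.length := by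
    intro k
    induction k with
    | zero => exact ⟨∅, [], by simp⟩
    | succ k ih =>
      obtain ⟨D, l, hD, hl, hc, hlD, hDu, hDX, hDY, hlW, hk⟩ := ih
      have hln := hE l hl hc
      have hlarge : ∀ Z : Finset V, 2 * q + n ≤ Z.card → (D ∩ Z).card ≤ q →
          q < ((Z \ D) \ l.toFinset).card := fun Z hZ hDZ => by
        have h₁ := Finset.le_card_sdiff l.toFinset (Z \ D)
        have h₂ := List.toFinset_card_le l
        have h₃ := Finset.card_inter_add_card_sdiff Z D
        rw [Finset.inter_comm] at h₃
        omega
      have hmem : ∀ Z : Finset V, ∀ u ∈ (Z \ D) \ l.toFinset, u ∈ Z ∧ u ∉ D ∧ u ∉ l :=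
        fun Z u hu => by simpa [and_assoc] using hu
      have hltX : (D ∩ X).card < q := by
        refine lt_of_le_of_ne hDX fun h => ?_
        obtain ⟨a, ha, b, hb, hab⟩ := hno (D ∩ X) Finset.inter_subset_right
          ((Y \ D) \ l.toFinset) (Finset.sdiff_subset.trans Finset.sdiff_subset) h.ge
          (hlarge Y hY hDY).le
        obtain ⟨hb₁, hb₂, hb₃⟩ := hmem _ _ hb
        exact hDu a (Finset.mem_inter.mp ha).1 b (Finset.mem_union_right _ hb₁) hb₂ hb₃ hab
      have hltY : (D ∩ Y).card < q := by
        refine lt_of_le_of_ne hDY fun h => ?_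
        obtain ⟨a, ha, b, hb, hab⟩ := hno ((X \ D) \ l.toFinset)
          (Finset.sdiff_subset.trans Finset.sdiff_subset) (D ∩ Y) Finset.inter_subset_right
          (hlarge X hX hDX).le h.ge
        obtain ⟨ha₁, ha₂, ha₃⟩ := hmem _ _ ha
        exact hDu b (Finset.mem_inter.mp hb).1 a (Finset.mem_union_left _ ha₁) ha₂ ha₃
          (hsymm _ _ hab)
      have hpush : ∀ u ∈ X ∪ Y, u ∉ D → u ∉ l → (u :: l).IsChain E →
          ∃ (D : Finset V) (l : List V), D ⊆ X ∪ Y ∧ l.Nodup ∧ l.IsChain E ∧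
          (∀ v ∈ l, v ∉ D) ∧ (∀ d ∈ D, ∀ u ∈ X ∪ Y, u ∉ D → u ∉ l → ¬ E d u) ∧
          (D ∩ X).card ≤ q ∧ (D ∩ Y).card ≤ q ∧ (∀ v ∈ l, v ∈ X ∪ Y) ∧
          k + 1 ≤ 2 * D.card + l.length := fun u hu huD hul huc =>
        ⟨D, u :: l, hD, List.nodup_cons.mpr ⟨hul, hl⟩, huc,
          by simpa using ⟨huD, hlD⟩,
          fun d hd w hw hwD hwl => hDu d hd w hw hwD fun h => hwl (List.mem_cons_of_mem _ h),
          hDX, hDY, by simpa using ⟨by simpa using hu, by simpa using hlW⟩,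
          by rw [List.length_cons]; omega⟩
      cases l with
      | nil =>
        obtain ⟨u, hu⟩ := Finset.card_pos.mp (Nat.zero_lt_of_lt (hlarge X hX hDX))
        obtain ⟨hu₁, hu₂, hu₃⟩ := hmem _ _ hu
        exact hpush u (Finset.mem_union_left _ hu₁) hu₂ hu₃ (by simp)
      | cons x l =>
        by_cases hx : ∃ u ∈ X ∪ Y, u ∉ D ∧ u ∉ x :: l ∧ E u x
        · obtain ⟨u, hu, huD, hul, hux⟩ := hx
          exact hpush u hu huD hul (List.isChain_cons_cons.mpr ⟨hux, hc⟩)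
        · push Not at hx
          have hxD := hlD x List.mem_cons_self
          have hxl := (List.nodup_cons.mp hl).1
          have hins : ∀ Z : Finset V, (insert x D ∩ Z).card ≤ (D ∩ Z).card + 1 := fun Z => by
            refine (Finset.card_le_card (t := insert x (D ∩ Z)) ?_).trans (Finset.card_insert_le _ _)
            intro v hv
            simp only [Finset.mem_inter, Finset.mem_insert] at hv ⊢
            tauto
          refine ⟨insert x D, l, Finset.insert_subset (hlW x List.mem_cons_self) hD,
            (List.nodup_cons.mp hl).2, hc.tail, fun v hv => ?_, fun d hd u hu huD hul => ?_,
            (hins X).trans hltX, (hins Y).trans hltY,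
            fun v hv => hlW v (List.mem_cons_of_mem _ hv), ?_⟩
          · rw [Finset.mem_insert, not_or]
            exact ⟨fun h => hxl (h ▸ hv), hlD v (List.mem_cons_of_mem _ hv)⟩
          · rw [Finset.mem_insert, not_or] at huD
            have hul' : u ∉ x :: l := by simpa using ⟨huD.1, hul⟩
            rcases Finset.mem_insert.mp hd with rfl | hd
            · exact fun h => hx u hu huD.2 hul' (hsymm _ _ h)
            · exact hDu d hd u hu huD.2 hul'
          · rw [Finset.card_insert_of_notMem hxD]
            rw [List.length_cons] at hk
            omega
  obtain ⟨D, l, hD, hl, hc, -, -, -, -, -, hk⟩ := key (2 * (X ∪ Y).card + n)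
  have := Finset.card_le_card hD
  have := hE l hl hc
  omega

/-- Between two large disjoint sets of an expanding graph there is an almost perfect matching. -/
theorem exists_matching {V : Type} [DecidableEq V] (F : SimpleGraph V) (n : ℕ)
    (hF : ∀ A B : Finset V, Disjoint A B → n ≤ A.card → n ≤ B.card → ∃ a ∈ A, ∃ b ∈ B, F.Adj a b)
    (X Y : Finset V) (hXY : Disjoint X Y) (hcard : X.card ≤ Y.card) :
    ∃ Z ⊆ X, X.card ≤ Z.card + n ∧ ∃ f : V → V, Set.InjOn f Z ∧
      ∀ z ∈ Z, f z ∈ Y ∧ F.Adj z (f z) := by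
  classical
  let P : Finset V → Prop := fun Z => ∃ f : V → V, Set.InjOn f Z ∧
      ∀ z ∈ Z, f z ∈ Y ∧ F.Adj z (f z)
  have hne : (X.powerset.filter P).Nonempty :=
    ⟨∅, by simp only [Finset.mem_filter, Finset.empty_mem_powerset, true_and]; exact ⟨id, by simp⟩⟩
  -- In a maximum partial matching, more than `n` unmatched vertices of `X` would leave as many in
  -- `Y`, and an edge between the two leftovers would extend it.
  obtain ⟨Z, hZ, hmax⟩ := Finset.exists_max_image _ Finset.card hne
  simp only [Finset.mem_filter, Finset.mem_powerset] at hZ hmax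
  obtain ⟨hZX, f, hinj, hf⟩ := hZ
  refine ⟨Z, hZX, ?_, f, hinj, hf⟩
  by_contra! hlt
  have h₁ : (X \ Z).card = X.card - Z.card := Finset.card_sdiff_of_subset hZX
  have h₂ : (Y \ Z.image f).card = Y.card - Z.card := by
    rw [Finset.card_sdiff_of_subset (Finset.image_subset_iff.mpr fun z hz => (hf z hz).1),
      Finset.card_image_of_injOn hinj]
  obtain ⟨a, ha, b, hb, hab⟩ := hF (X \ Z) (Y \ Z.image f)
    (hXY.mono Finset.sdiff_subset Finset.sdiff_subset) (by omega) (by omega)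
  rw [Finset.mem_sdiff] at ha hb
  have hne' : ∀ z ∈ Z, z ≠ a := fun z hz h => ha.2 (h ▸ hz)
  have := hmax (insert a Z) ⟨Finset.insert_subset ha.1 hZX, Function.update f a b, ?_, ?_⟩
  · rw [Finset.card_insert_of_notMem ha.2] at this
    omega
  · rw [Finset.coe_insert, Set.injOn_insert (by simpa using ha.2)]
    refine ⟨fun x hx y hy h => ?_, ?_⟩
    · rw [Function.update_of_ne (hne' x hx), Function.update_of_ne (hne' y hy)] at h
      exact hinj hx hy h
    · rintro ⟨z, hz, h⟩
      rw [Function.update_of_ne (hne' z hz), Function.update_self] at h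
      exact hb.2 (Finset.mem_image.mpr ⟨z, hz, h⟩)
  · intro z hz
    rcases Finset.mem_insert.mp hz with rfl | hz
    · simpa using ⟨hb.1, hab⟩
    · rw [Function.update_of_ne (hne' z hz)]
      exact hf z hz

/-- Simultaneous version of `exists_unrelated_subsets` for finitely many relations between the
members of a family of disjoint sets. -/
theorem exists_unrelated_family {V ι κ : Type} [DecidableEq V] (T : Finset κ) (s t : κ → ι)
    (hst : ∀ r ∈ T, s r ≠ t r) (rel : κ → V → V → Prop) (n q : ℕ) (X : ι → Finset V)
    (hX : ∀ i, 3 ^ T.card * (q + n) ≤ (X i).card)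
    (hlong : ∀ r ∈ T, ∀ l : List V, l.Nodup →
      l.IsChain (fun v w => (v ∈ X (s r) ∧ w ∈ X (t r) ∧ rel r v w) ∨
        (w ∈ X (s r) ∧ v ∈ X (t r) ∧ rel r w v)) → l.length < n) :
    ∃ X' : ι → Finset V, (∀ i, X' i ⊆ X i) ∧ (∀ i, q ≤ (X' i).card) ∧
      ∀ r ∈ T, ∀ v ∈ X' (s r), ∀ w ∈ X' (t r), ¬ rel r v w := by
  classical
  induction T using Finset.induction_on generalizing X with
  | empty => exact ⟨X, fun _ => le_rfl, fun i => by have := hX i; simp at this; omega, by simp⟩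
  | insert r T hr ih =>
    -- Each relation costs a factor 3: sets of size `3 * Q ≥ 2 * Q + n` shrink to size `Q`.
    set Q := 3 ^ T.card * (q + n) with hQ
    have hnQ : n ≤ Q := by
      rw [hQ]; exact le_trans (by omega) (Nat.le_mul_of_pos_left _ (by positivity))
    have hX' : ∀ i, 2 * Q + n ≤ (X i).card := fun i => by
      have := hX i
      rw [Finset.card_insert_of_notMem hr, pow_succ] at this
      have h3 : 3 ^ T.card * 3 * (q + n) = 3 * Q := by rw [hQ]; ring
      omega
    have hrs := hst r (Finset.mem_insert_self _ _)
    obtain ⟨A, hA, B, hB, hAq, hBq, hAB⟩ := exists_unrelated_subsets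
      (fun v w => (v ∈ X (s r) ∧ w ∈ X (t r) ∧ rel r v w) ∨
        (w ∈ X (s r) ∧ v ∈ X (t r) ∧ rel r w v)) (fun _ _ h => h.symm) (X (s r)) (X (t r))
      n Q (hX' _) (hX' _) (hlong r (Finset.mem_insert_self _ _))
    let X₁ : ι → Finset V := fun i => if i = s r then A else if i = t r then B else X i
    have hX₁s : X₁ (s r) = A := by simp [X₁]
    have hX₁t : X₁ (t r) = B := by simp [X₁, hrs.symm]
    have hsub : ∀ i, X₁ i ⊆ X i := fun i => by
      simp only [X₁]
      split_ifs with h₁ h₂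
      · exact h₁ ▸ hA
      · exact h₂ ▸ hB
      · exact le_rfl
    obtain ⟨X', h₁, h₂, h₃⟩ := ih (fun r hr => hst r (Finset.mem_insert_of_mem hr)) X₁
      (fun i => by
        simp only [X₁]
        split_ifs
        · exact hAq
        · exact hBq
        · have := hX' i; omega)
      (fun r hr l hl hc => hlong r (Finset.mem_insert_of_mem hr) l hl (hc.imp fun v w h =>
        h.imp (fun h => ⟨hsub _ h.1, hsub _ h.2.1, h.2.2⟩)
          (fun h => ⟨hsub _ h.1, hsub _ h.2.1, h.2.2⟩)))
    refine ⟨X', fun i => (h₁ i).trans (hsub i), h₂, fun r' hr' v hv w hw => ?_⟩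
    rcases Finset.mem_insert.mp hr' with rfl | hr'
    · intro h
      have hv' := h₁ _ hv
      have hw' := h₁ _ hw
      rw [hX₁s] at hv'
      rw [hX₁t] at hw'
      exact hAB v hv' w hw' (Or.inl ⟨hA hv', hB hw', h⟩)
    · exact h₃ r' hr' v hv w hw

/-! ### Expanders of bounded degree. -/

theorem exists_pow_mul_pow_lt (K : ℕ) (hK : 0 < K) : ∃ d : ℕ, 4 ^ K * (K - 1) ^ d < K ^ d := by
  have hK' : (0 : ℝ) < K := by exact_mod_cast hK
  obtain ⟨d, hd⟩ := exists_pow_lt_of_lt_one (x := ((4 : ℝ) ^ K)⁻¹) (y := ((K - 1 : ℕ) : ℝ) / K)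
    (by positivity) (by rw [div_lt_one hK']; exact_mod_cast Nat.sub_lt hK one_pos)
  refine ⟨d, ?_⟩
  rw [div_pow, div_lt_iff₀ (by positivity), inv_mul_eq_div, lt_div_iff₀ (by positivity),
    mul_comm] at hd
  exact_mod_cast hd

/-- A counting argument: a bounded number of self-maps suffices to connect any two sets of
positive density. -/
theorem exists_mixing_functions (K : ℕ) (hK : 0 < K) : ∃ d : ℕ, ∀ n, 0 < n →
    ∃ f : Fin d × Fin (K * n) → Fin (K * n), ∀ A B : Finset (Fin (K * n)), A.card = n →
      B.card = n → ∃ i, ∃ a ∈ A, f (i, a) ∈ B := by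
  classical
  obtain ⟨d, hd⟩ := exists_pow_mul_pow_lt K hK
  refine ⟨d, fun n hn => ?_⟩
  by_contra! hno
  set N := K * n with hN
  let P := ((Finset.univ : Finset (Fin N)).powersetCard n) ×ˢ
    ((Finset.univ : Finset (Fin N)).powersetCard n)
  -- Union bound: `bad (A, B)` consists of the `f` sending no point of `A` into `B`. A proportion
  -- `(1 - 1/K)^(d * n)` of all `f` is bad for a given pair, and there are at most `4^(K * n)`
  -- pairs.
  let bad : Finset (Fin N) × Finset (Fin N) → Finset (Fin d × Fin N → Fin N) := fun p =>
    Fintype.piFinset fun x => if x.2 ∈ p.1 then p.2ᶜ else Finset.univ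
  have hcover : (Finset.univ : Finset (Fin d × Fin N → Fin N)) ⊆ P.biUnion bad := by
    intro f _
    obtain ⟨A, B, hA, hB, h⟩ := hno f
    refine Finset.mem_biUnion.mpr ⟨(A, B), by simp [P, hA, hB], ?_⟩
    rw [Fintype.mem_piFinset]
    rintro ⟨i, a⟩
    dsimp only
    split_ifs with ha
    · exact Finset.mem_compl.mpr (h i a ha)
    · exact Finset.mem_univ _
  have hbad : ∀ p ∈ P, (bad p).card = ((N - n) ^ n * N ^ (N - n)) ^ d := by
    rintro ⟨A, B⟩ hp
    simp only [P, Finset.mem_product, Finset.mem_powersetCard_univ] at hp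
    have h₁ : ∀ x : Fin d × Fin N, (if x.2 ∈ A then Bᶜ else Finset.univ).card =
        if x.2 ∈ A then N - n else N := fun x => by
      split_ifs
      · rw [Finset.card_compl, hp.2, Fintype.card_fin]
      · simp
    rw [Fintype.card_piFinset, Finset.prod_congr rfl fun x _ => h₁ x, Fintype.prod_prod_type]
    have h₂ : (∏ u : Fin N, if u ∈ A then N - n else N) = (N - n) ^ n * N ^ (N - n) := by
      rw [Finset.prod_ite, Finset.prod_const, Finset.prod_const, Finset.filter_mem_eq_inter,
        Finset.univ_inter, hp.1, Finset.filter_not, Finset.filter_mem_eq_inter, Finset.univ_inter,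
        Finset.card_univ_sdiff, Fintype.card_fin, hp.1]
    simp [h₂]
  have hPcard : P.card ≤ 4 ^ N := by
    have : (((Finset.univ : Finset (Fin N)).powersetCard n)).card ≤ 2 ^ N := by
      rw [Finset.card_powersetCard, Finset.card_univ, Fintype.card_fin]
      exact Nat.choose_le_two_pow _ _
    calc P.card ≤ 2 ^ N * 2 ^ N := by
          rw [Finset.card_product]; exact Nat.mul_le_mul this this
      _ = 4 ^ N := by rw [← mul_pow]; norm_num
  have hle := (Finset.card_le_card hcover).trans Finset.card_biUnion_le
  rw [Finset.sum_congr rfl hbad, Finset.sum_const, smul_eq_mul, Finset.card_univ,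
    Fintype.card_fun, Fintype.card_prod, Fintype.card_fin, Fintype.card_fin] at hle
  have hNpos : 0 < N := Nat.mul_pos hK hn
  have hnN : n ≤ N := Nat.le_mul_of_pos_left n hK
  have hsub : N - n = (K - 1) * n := by rw [Nat.sub_mul, one_mul]
  have hlt : 4 ^ N * ((N - n) ^ n * N ^ (N - n)) ^ d < N ^ (d * N) := by
    have h₁ : 4 ^ N * ((N - n) ^ n * N ^ (N - n)) ^ d =
        (4 ^ K * (K - 1) ^ d) ^ n * (n ^ n * N ^ (N - n)) ^ d := by
      rw [hsub, hN, pow_mul, mul_pow, mul_pow, mul_pow, mul_pow, mul_pow, ← pow_mul, ← pow_mul,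
        mul_comm n d, ← pow_mul]
      ring
    have h₂ : N ^ (d * N) = (K ^ d) ^ n * (n ^ n * N ^ (N - n)) ^ d := by
      conv_lhs => rw [mul_comm d N, pow_mul, ← Nat.add_sub_cancel' hnN, pow_add,
        Nat.add_sub_cancel' hnN]
      have : N ^ n = K ^ n * n ^ n := by rw [hN, mul_pow]
      rw [this]
      ring
    rw [h₁, h₂]
    exact Nat.mul_lt_mul_of_pos_right (Nat.pow_lt_pow_left hd hn.ne') (by positivity)
  exact absurd (hle.trans (Nat.mul_le_mul_right _ hPcard)) (not_le.mpr hlt)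

/-- Bounded degree graphs with an edge between any two disjoint sets of given positive density. -/
theorem exists_bounded_degree_expander (C : ℕ) (hC : 0 < C) : ∃ d : ℕ, ∀ n, 0 < n →
    ∃ F : SimpleGraph (Fin (C * n)),
      (∀ v, ∃ N : Finset (Fin (C * n)), N.card ≤ d ∧ ∀ w, F.Adj v w → w ∈ N) ∧
      ∀ A B : Finset (Fin (C * n)), Disjoint A B → n ≤ A.card → n ≤ B.card →
        ∃ a ∈ A, ∃ b ∈ B, F.Adj a b := by
  classical
  obtain ⟨d, hd⟩ := exists_mixing_functions (2 * C) (by omega)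
  refine ⟨3 * d, fun n hn => ?_⟩
  have hmix := hd n hn
  obtain ⟨N, hN⟩ : ∃ N, N = 2 * C * n := ⟨_, rfl⟩
  rw [← hN] at hmix
  obtain ⟨f, hf⟩ := hmix
  let indeg : Fin N → Finset (Fin d × Fin N) := fun v => Finset.univ.filter fun x => f x = v
  -- Out-degrees are at most `d`, so in-degrees average `d`, and at least half of the `2 * C * n`
  -- vertices have in-degree at most `2 * d`. The graph is restricted to `C * n` of these.
  let S : Finset (Fin N) := Finset.univ.filter fun v => (indeg v).card ≤ 2 * d
  have hS : C * n ≤ S.card := by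
    have hsum : ∑ v, (indeg v).card = d * N := by
      have := Finset.card_eq_sum_card_fiberwise (f := f) (s := Finset.univ) (t := Finset.univ)
        (fun _ _ => Finset.mem_univ _)
      simpa [indeg] using this.symm
    have h₁ : Sᶜ.card * (2 * d + 1) ≤ d * N := by
      rw [← hsum, ← smul_eq_mul, ← Finset.sum_const]
      refine (Finset.sum_le_sum fun v hv => ?_).trans
        (Finset.sum_le_sum_of_subset (Finset.subset_univ Sᶜ))
      simpa [S, Nat.succ_le_iff] using hv
    have h₂ : Sᶜ.card = N - S.card := by rw [Finset.card_compl, Fintype.card_fin]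
    by_contra! hlt
    have h₃ : C * n + 1 ≤ Sᶜ.card := by
      have : N = C * n + C * n := by rw [hN]; ring
      omega
    have h₄ := (Nat.mul_le_mul_right (2 * d + 1) h₃).trans h₁
    have : d * N = C * n * (2 * d) := by rw [hN]; ring
    nlinarith
  obtain ⟨S', hS'S, hS'⟩ := Finset.exists_subset_card_eq hS
  let g : Fin (C * n) ↪o Fin N := S'.orderEmbOfFin hS'
  have hg : ∀ v, (indeg (g v)).card ≤ 2 * d := fun v =>
    (Finset.mem_filter.mp (hS'S (S'.orderEmbOfFin_mem hS' v))).2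
  let F : SimpleGraph (Fin (C * n)) :=
    SimpleGraph.fromRel fun v w => ∃ i, f (i, g v) = g w
  refine ⟨F, fun v => ⟨Finset.univ.filter fun w => g w ∈
    (Finset.univ.image fun i => f (i, g v)) ∪ (indeg (g v)).image Prod.snd, ?_, ?_⟩, ?_⟩
  · have h₁ : (Finset.univ.image fun i => f (i, g v)).card ≤ d := by
      simpa using Finset.card_image_le (s := (Finset.univ : Finset (Fin d)))
        (f := fun i => f (i, g v))
    have h₂ : ((indeg (g v)).image Prod.snd).card ≤ 2 * d := Finset.card_image_le.trans (hg v)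
    rw [← Finset.card_map g.toEmbedding]
    refine (Finset.card_le_card (t := (Finset.univ.image fun i => f (i, g v)) ∪
      (indeg (g v)).image Prod.snd) ?_).trans ((Finset.card_union_le _ _).trans (by omega))
    intro w hw
    obtain ⟨u, hu, rfl⟩ := Finset.mem_map.mp hw
    exact (Finset.mem_filter.mp hu).2
  · intro w hw
    rw [SimpleGraph.fromRel_adj] at hw
    simp only [Finset.mem_filter, Finset.mem_univ, true_and, Finset.mem_union, Finset.mem_image]
    rcases hw.2 with ⟨i, h⟩ | ⟨i, h⟩
    · exact Or.inl ⟨i, h⟩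
    · exact Or.inr ⟨(i, g w), by simp [indeg, h], rfl⟩
  · intro A B hAB hA hB
    obtain ⟨A', hA'A, hA'⟩ := Finset.exists_subset_card_eq hA
    obtain ⟨B', hB'B, hB'⟩ := Finset.exists_subset_card_eq hB
    obtain ⟨i, a, ha, hb⟩ := hf (A'.map g.toEmbedding) (B'.map g.toEmbedding)
      (by rw [Finset.card_map, hA']) (by rw [Finset.card_map, hB'])
    obtain ⟨a, ha', rfl⟩ := Finset.mem_map.mp ha
    obtain ⟨b, hb, hab⟩ := Finset.mem_map.mp hb
    refine ⟨a, hA'A ha', b, hB'B hb, ?_⟩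
    rw [SimpleGraph.fromRel_adj]
    refine ⟨fun h => Finset.disjoint_left.mp hAB (hA'A ha') (h ▸ hB'B hb), Or.inl ⟨i, hab.symm⟩⟩

/-! ### Thick paths and systems of clusters. -/

/-- `H` contains the graph whose vertex set is split into `n` consecutive blocks of size `K`, any
two vertices in equal or consecutive blocks being adjacent. -/
def HasThickPath {V : Type} (H : SimpleGraph V) (n K : ℕ) : Prop :=
  ∃ q : Fin n → Fin K → V, (∀ i j a b, q i a = q j b → i = j ∧ a = b) ∧
    (∀ i a b, a ≠ b → H.Adj (q i a) (q i b)) ∧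
    ∀ (i j : Fin n) (a b : Fin K), (i : ℕ) + 1 = j → H.Adj (q i a) (q j b)

/-- Families of `ℓ`-dimensional boxes of vertices, placed close to their centres, such that
the lines of a box in each of the `ℓ` directions are monochromatic in `ℓ` different colours. -/
structure ClusterSystem {V : Type} (F : SimpleGraph V) {s : ℕ} (col : V → V → Fin s)
    (ι : Type) (ℓ M b : ℕ) where
  centers : ι → Finset V
  disj : ∀ i j, i ≠ j → Disjoint (centers i) (centers j)
  le_card : ∀ i, b ≤ (centers i).card
  point : V → (Fin ℓ → Fin M) → V
  colour : V → Fin ℓ → Fin s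
  near : ∀ i, ∀ v ∈ centers i, ∀ x, F.edist v (point v x) ≤ ℓ
  inj : ∀ i j, ∀ v ∈ centers i, ∀ w ∈ centers j, ∀ x y, point v x = point w y → v = w ∧ x = y
  colour_inj : ∀ i, ∀ v ∈ centers i, Function.Injective (colour v)
  line : ∀ i, ∀ v ∈ centers i, ∀ x j a b, a ≠ b →
    col (point v (Function.update x j a)) (point v (Function.update x j b)) = colour v j

namespace ClusterSystem

variable {V : Type} {F : SimpleGraph V} {s : ℕ} {col : V → V → Fin s} {ι : Type} {ℓ M b : ℕ}

/-- All pairs of points in given sub-boxes of two nearby clusters have the colour `γ`, and `γ` is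
one of the line colours of both clusters. -/
def Linked (S : ClusterSystem F col ι ℓ M b) {m : ℕ} (γ : Fin s)
    (e e' : Fin ℓ → (Fin m ↪ Fin M)) (v w : V) : Prop :=
  F.edist v w ≤ 2 ∧ (∃ j, S.colour v j = γ) ∧ (∃ j, S.colour w j = γ) ∧
    ∀ x y : Fin ℓ → Fin m,
      col (S.point v fun t => e t (x t)) (S.point w fun t => e' t (y t)) = γ

/-- Each cluster on the path contributes, as a block, `K` points of a `γ`-coloured line in its
sub-box; linkedness joins consecutive blocks in `γ`. All pairs used lie within distance `ℓ + 2 + ℓ ≤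
R`. As `n ≥ 2`, each cluster takes part in some link and so has `γ` among its line colours. -/
theorem hasThickPath_of_chain (S : ClusterSystem F col ι ℓ M b) (hsymm : ∀ v w, col v w = col w v)
    (H : Fin s → SimpleGraph V) (R : ℕ) (hR : 2 * ℓ + 2 ≤ R)
    (hH : ∀ v w, v ≠ w → F.edist v w ≤ R → (H (col v w)).Adj v w) {m K n : ℕ} (hK : K ≤ m)
    (hm : 0 < m) (hn : 2 ≤ n)
    (γ : Fin s) (e e' : Fin ℓ → (Fin m ↪ Fin M)) (i j : ι) (hij : i ≠ j) (l : List V)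
    (hl : l.Nodup) (hln : n ≤ l.length)
    (hc : l.IsChain fun v w => (v ∈ S.centers i ∧ w ∈ S.centers j ∧ S.Linked γ e e' v w) ∨
      (w ∈ S.centers i ∧ v ∈ S.centers j ∧ S.Linked γ e e' w v)) :
    HasThickPath (H γ) n K := by
  classical
  have hstep : ∀ (k : ℕ) (h : k + 1 < l.length),
      (l[k] ∈ S.centers i ∧ l[k + 1] ∈ S.centers j ∧ S.Linked γ e e' l[k] l[k + 1]) ∨
      (l[k + 1] ∈ S.centers i ∧ l[k] ∈ S.centers j ∧ S.Linked γ e e' l[k + 1] l[k]) :=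
    fun k h => List.isChain_iff_getElem.mp hc k h
  have hvert : ∀ (k : ℕ) (h : k < l.length),
      (l[k] ∈ S.centers i ∨ l[k] ∈ S.centers j) ∧ ∃ t, S.colour l[k] t = γ := by
    intro k h
    rcases Nat.lt_or_ge (k + 1) l.length with h' | h'
    · rcases hstep k h' with h | h
      · exact ⟨Or.inl h.1, h.2.2.2.1⟩
      · exact ⟨Or.inr h.2.1, h.2.2.2.2.1⟩
    · obtain ⟨k, rfl⟩ : ∃ k', k = k' + 1 := ⟨k - 1, by omega⟩
      rcases hstep k h with h | h
      · exact ⟨Or.inr h.2.1, h.2.2.2.2.1⟩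
      · exact ⟨Or.inl h.1, h.2.2.2.1⟩
  let emb : V → Fin ℓ → (Fin m ↪ Fin M) := fun v => if v ∈ S.centers i then e else e'
  have hembi : ∀ v ∈ S.centers i, emb v = e := fun v hv => if_pos hv
  have hembj : ∀ v ∈ S.centers j, emb v = e' := fun v hv =>
    if_neg fun h => Finset.disjoint_left.mp (S.disj i j hij) h hv
  choose hmem t ht using hvert
  have hlt : ∀ k : Fin n, (k : ℕ) < l.length := fun k => k.2.trans_le hln
  let x₀ : Fin ℓ → Fin m := fun _ => ⟨0, hm⟩
  let q : Fin n → Fin K → V := fun k a => S.point l[k] fun u =>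
    emb l[k] u (Function.update x₀ (t k (hlt k)) (Fin.castLE hK a) u)
  have hcent : ∀ k : Fin n, ∃ i', l[k] ∈ S.centers i' := fun k =>
    (hmem k (hlt k)).elim (fun h => ⟨i, h⟩) fun h => ⟨j, h⟩
  have hinj : ∀ k k' a a', q k a = q k' a' → k = k' ∧ a = a' := by
    intro k k' a a' h
    obtain ⟨i₁, h₁⟩ := hcent k
    obtain ⟨i₂, h₂⟩ := hcent k'
    obtain ⟨hv, hx⟩ := S.inj i₁ i₂ _ h₁ _ h₂ _ _ h
    have hkk : k = k' := Fin.ext ((List.Nodup.getElem_inj_iff hl).mp hv)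
    subst hkk
    refine ⟨rfl, ?_⟩
    have := congrFun hx (t k (hlt k))
    simpa using this
  have hdist : ∀ k k' : Fin n, F.edist l[k] l[k'] ≤ 2 → ∀ a a',
      F.edist (q k a) (q k' a') ≤ R := by
    intro k k' h a a'
    obtain ⟨i₁, h₁⟩ := hcent k
    obtain ⟨i₂, h₂⟩ := hcent k'
    have h₃ := S.near i₁ _ h₁ (fun u => emb l[k] u
      (Function.update x₀ (t k (hlt k)) (Fin.castLE hK a) u))
    have h₄ := S.near i₂ _ h₂ (fun u => emb l[k'] u
      (Function.update x₀ (t k' (hlt k')) (Fin.castLE hK a') u))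
    rw [SimpleGraph.edist_comm] at h₃
    calc F.edist (q k a) (q k' a') ≤ F.edist (q k a) l[k] + F.edist l[k] (q k' a') :=
          SimpleGraph.edist_triangle
      _ ≤ ℓ + (2 + ℓ) := add_le_add h₃ (SimpleGraph.edist_triangle.trans (add_le_add h h₄))
      _ ≤ R := by exact_mod_cast (by omega : ℓ + (2 + ℓ) ≤ R)
  refine ⟨q, hinj, fun k a a' ha => ?_, fun k k' a a' hk => ?_⟩
  · obtain ⟨i₁, h₁⟩ := hcent k
    have hline := S.line i₁ _ h₁ (fun u => emb l[k] u (x₀ u)) (t k (hlt k))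
      (emb l[k] (t k (hlt k)) (Fin.castLE hK a)) (emb l[k] (t k (hlt k)) (Fin.castLE hK a'))
      (by simpa using ha)
    have hupd : ∀ a : Fin K, q k a = S.point l[k] (Function.update (fun u => emb l[k] u (x₀ u))
        (t k (hlt k)) (emb l[k] (t k (hlt k)) (Fin.castLE hK a))) := fun a =>
      congrArg _ (funext fun u =>
        Function.apply_update (fun u => emb l[k] u) x₀ (t k (hlt k)) (Fin.castLE hK a) u)
    have hcol : col (q k a) (q k a') = γ := by
      rw [hupd, hupd, hline]
      exact ht k (hlt k)
    rw [← hcol]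
    exact hH _ _ (fun h => ha (hinj _ _ _ _ h).2)
      (hdist k k (by simp) a a')
  · have hk₁ : (k : ℕ) + 1 < l.length := hk ▸ hlt k'
    have hkk : l[k'] = l[(k : ℕ) + 1] := by simp [hk]
    have hne : q k a ≠ q k' a' := fun h => by
      have := congrArg Fin.val (hinj _ _ _ _ h).1
      omega
    have : F.edist l[k] l[k'] ≤ 2 ∧ col (q k a) (q k' a') = γ := by
      rcases hstep k hk₁ with h | h
      · rw [← hkk] at h
        refine ⟨h.2.2.1, ?_⟩
        have := h.2.2.2.2.2 (Function.update x₀ (t k (hlt k)) (Fin.castLE hK a))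
          (Function.update x₀ (t k' (hlt k')) (Fin.castLE hK a'))
        rw [← hembi _ h.1, ← hembj _ h.2.1] at this
        exact this
      · rw [← hkk] at h
        refine ⟨by rw [SimpleGraph.edist_comm]; exact h.2.2.1, ?_⟩
        have := h.2.2.2.2.2 (Function.update x₀ (t k' (hlt k')) (Fin.castLE hK a'))
          (Function.update x₀ (t k (hlt k)) (Fin.castLE hK a))
        rw [← hembi _ h.1, ← hembj _ h.2.1, hsymm] at this
        exact this
    rw [← this.2]
    exact hH _ _ hne (hdist k k' this.1 a a')

/-- If there is no monochromatic thick path, we may pass to large families of clusters without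
linked pairs. -/
theorem exists_unlinked (ι : Type) [Finite ι] (s ℓ M m K : ℕ) (hK : K ≤ m) (hm : 0 < m) :
    ∃ B : ℕ, ∀ {V : Type} (F : SimpleGraph V) (col : V → V → Fin s) (n b : ℕ)
      (_ : ClusterSystem F col ι ℓ M (B * (b + n))) (_ : 2 ≤ n)
      (_ : ∀ v w, col v w = col w v) (H : Fin s → SimpleGraph V) (R : ℕ) (_ : 2 * ℓ + 2 ≤ R)
      (_ : ∀ v w, v ≠ w → F.edist v w ≤ R → (H (col v w)).Adj v w)
      (_ : ∀ γ, ¬ HasThickPath (H γ) n K),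
      ∃ S' : ClusterSystem F col ι ℓ M b, ∀ i j, i ≠ j → ∀ γ, ∀ e e' : Fin ℓ → (Fin m ↪ Fin M),
        ∀ v ∈ S'.centers i, ∀ w ∈ S'.centers j, ¬ S'.Linked γ e e' v w := by
  classical
  have := Fintype.ofFinite ι
  let κ := {p : ι × ι // p.1 ≠ p.2} × Fin s × (Fin ℓ → (Fin m ↪ Fin M)) ×
    (Fin ℓ → (Fin m ↪ Fin M))
  refine ⟨3 ^ (Finset.univ : Finset κ).card, fun {V} F col n b S hn hsymm H R hR hH hno => ?_⟩
  obtain ⟨X, hX, hXb, hXrel⟩ := exists_unrelated_family (Finset.univ : Finset κ)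
    (fun r => r.1.1.1) (fun r => r.1.1.2) (fun r _ => r.1.2)
    (fun r => S.Linked r.2.1 r.2.2.1 r.2.2.2) n b S.centers S.le_card (fun r _ l hl hc => by
      by_contra! hln
      exact hno r.2.1 (S.hasThickPath_of_chain hsymm H R hR hH hK hm hn r.2.1 r.2.2.1 r.2.2.2
        r.1.1.1 r.1.1.2 r.1.2 l hl hln hc))
  exact ⟨{ S with
      centers := X
      disj := fun i j hij => (S.disj i j hij).mono (hX i) (hX j)
      le_card := hXb
      near := fun i v hv => S.near i v (hX i hv)
      inj := fun i j v hv w hw => S.inj i j v (hX i hv) w (hX j hw)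
      colour_inj := fun i v hv => S.colour_inj i v (hX i hv)
      line := fun i v hv => S.line i v (hX i hv) },
    fun i j hij γ e e' v hv w hw =>
      hXrel (⟨(i, j), hij⟩, γ, e, e') (Finset.mem_univ _) v hv w hw⟩

end ClusterSystem

/-! ### Raising the dimension of the clusters. -/

namespace ClusterSystem

/-- In the absence of monochromatic thick paths, clusters can be combined to clusters of one more
dimension. -/
theorem exists_succ (ι : Type) [Finite ι] (s ℓ M K : ℕ) :
    ∃ (ι' : Type) (_ : Finite ι') (M' B : ℕ), ∀ {V : Type} (F : SimpleGraph V)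
      (col : V → V → Fin s) (n b : ℕ) (_ : ClusterSystem F col ι' ℓ M' (B * (b + n))) (_ : 2 ≤ n)
      (_ : ∀ v w, col v w = col w v) (H : Fin s → SimpleGraph V) (R : ℕ) (_ : 2 * ℓ + 2 ≤ R)
      (_ : ∀ v w, v ≠ w → F.edist v w ≤ R → (H (col v w)).Adj v w)
      (_ : ∀ γ, ¬ HasThickPath (H γ) n K)
      (_ : ∀ A B : Finset V, Disjoint A B → n ≤ A.card → n ≤ B.card →
        ∃ a ∈ A, ∃ b ∈ B, F.Adj a b),
      Nonempty (ClusterSystem F col ι (ℓ + 1) M b) := by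
  classical
  obtain ⟨m, hMm, hKm, hm⟩ : ∃ m, M ≤ m ∧ K ≤ m ∧ 0 < m :=
    ⟨M + K + 1, by omega, by omega, by omega⟩
  -- The colour of a pair records the line colours of its smaller index only, so the last index is
  -- sacrificed; two more ensure that a pair of known line colours exists even when `M` is small.
  obtain ⟨L, hL⟩ := exists_homogeneous_strictMono ((Fin ℓ → Fin s) × Fin s) (M + 3)
  obtain ⟨M', hM'⟩ := exists_monochromatic_box (Fin L × Fin ℓ) (Fin L → Fin L → Fin s) m
  obtain ⟨B, hB⟩ := exists_unlinked (ι × Option (Fin L)) s ℓ M' m K hKm hm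
  refine ⟨ι × Option (Fin L), inferInstance, M', B * (L + 1),
    fun {V} F col n b S hn hsymm H R hR hH hno hF => ?_⟩
  -- The surplus `L * n` pays for the `L` matchings below, each missing at most `n` vertices.
  obtain ⟨S', hS'⟩ := hB F col n (b + L * n)
    { S with
      le_card := fun i => le_trans (by
        have : B * (L + 1) * (b + n) = B * (b + L * n + n) + B * (L * b) := by ring
        omega) (S.le_card i) } hn hsymm H R hR hH hno
  choose Y hY hYcard using fun i => Finset.exists_subset_card_eq (S'.le_card (i, none))
  choose Z hZ hZcard f hfinj hf using fun (i : ι) (t : Fin L) => exists_matching F n hF (Y i)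
    (S'.centers (i, some t)) ((S'.disj _ _ (by simp)).mono_left (hY i))
    ((hYcard i).trans_le (S'.le_card _))
  let C : ι → Finset V := fun i => (Y i).filter fun v => ∀ t, v ∈ Z i t
  have hCY : ∀ i, ∀ v ∈ C i, v ∈ S'.centers (i, none) := fun i v hv =>
    hY i (Finset.mem_filter.mp hv).1
  have hCZ : ∀ i, ∀ v ∈ C i, ∀ t, v ∈ Z i t := fun i v hv => (Finset.mem_filter.mp hv).2
  have hCuniq : ∀ i j v, v ∈ C i → v ∈ C j → i = j := fun i j v hi hj => by
    by_contra hij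
    exact Finset.disjoint_left.mp (S'.disj (i, none) (j, none) (by simpa using hij))
      (hCY i v hi) (hCY j v hj)
  have hCcard : ∀ i, b ≤ (C i).card := fun i => by
    have h₁ : Y i \ C i ⊆ Finset.univ.biUnion fun t => Y i \ Z i t := by
      intro v hv
      simp only [C, Finset.mem_sdiff, Finset.mem_filter, not_and, not_forall] at hv
      obtain ⟨t, ht⟩ := hv.2 hv.1
      exact Finset.mem_biUnion.mpr ⟨t, Finset.mem_univ _, Finset.mem_sdiff.mpr ⟨hv.1, ht⟩⟩
    have h₂ : (Y i \ C i).card ≤ L * n := by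
      refine (Finset.card_le_card h₁).trans ((Finset.card_biUnion_le_card_mul _ _ n
        fun t _ => ?_).trans (by simp))
      rw [Finset.card_sdiff_of_subset (hZ i t)]
      have := hZcard i t
      omega
    have h₃ := Finset.card_sdiff_of_subset (show C i ⊆ Y i from Finset.filter_subset _ _)
    rw [hYcard] at h₃
    omega
  have hchild : ∀ v, ∃ g : Fin L → V, ∀ i, v ∈ C i → ∀ t, g t = f i t v := fun v => by
    by_cases h : ∃ i, v ∈ C i
    · obtain ⟨i, hi⟩ := h
      exact ⟨fun t => f i t v, fun j hj t => by rw [hCuniq i j v hi hj]⟩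
    · exact ⟨fun _ => v, fun i hi => absurd ⟨i, hi⟩ h⟩
  choose child hchild using hchild
  have hmem : ∀ i, ∀ v ∈ C i, ∀ t, child v t ∈ S'.centers (i, some t) := fun i v hv t => by
    rw [hchild v i hv]
    exact (hf i t v (hCZ i v hv t)).1
  have hadj : ∀ i, ∀ v ∈ C i, ∀ t, F.Adj v (child v t) := fun i v hv t => by
    rw [hchild v i hv]
    exact (hf i t v (hCZ i v hv t)).2
  have hinj : ∀ i j, ∀ v ∈ C i, ∀ w ∈ C j, ∀ t t', child v t = child w t' → v = w ∧ t = t' := by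
    intro i j v hv w hw t t' h
    have hit : (i, some t) = (j, some t') := by
      by_contra hne
      exact Finset.disjoint_left.mp (S'.disj _ _ hne) (hmem i v hv t) (h ▸ hmem j w hw t')
    simp only [Prod.mk.injEq, Option.some.injEq] at hit
    obtain ⟨rfl, rfl⟩ := hit
    rw [hchild v i hv, hchild w i hw] at h
    exact ⟨hfinj i t (hCZ i v hv t) (hCZ i w hw t) h, rfl⟩
  -- One box in `L * ℓ` coordinates carries all `L` child clusters of `v` at once; its colour is the
  -- whole table of colours between children.
  choose e Γ hΓ using fun v => hM' M' le_rfl fun z t t' =>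
    col (S'.point (child v t) fun u => z (t, u)) (S'.point (child v t') fun u => z (t', u))
  choose τ c hτ hc using fun v => hL fun t t' => (S'.colour (child v t), Γ v t t')
  have hpair : ∀ v t t', t ≠ t' → ∀ y y' : Fin ℓ → Fin m,
      col (S'.point (child v t) fun u => e v (t, u) (y u))
        (S'.point (child v t') fun u => e v (t', u) (y' u)) = Γ v t t' := by
    intro v t t' htt' y y'
    have := congrFun (congrFun (hΓ v fun p => if p.1 = t then y p.2 else y' p.2) t) t'
    simpa [htt'.symm] using this
  have hcolour : ∀ v (a : Fin (M + 2)),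
      S'.colour (child v (τ v (Fin.castSucc a))) = (c v).1 := fun v a =>
    congrArg Prod.fst (hc v _ _ (Fin.castSucc_lt_last a))
  have hΓc : ∀ v a b, a < b → Γ v (τ v a) (τ v b) = (c v).2 := fun v a b hab =>
    congrArg Prod.snd (hc v a b hab)
  let σ : V → Fin M → Fin L := fun v a => τ v (Fin.castLE (by omega) a)
  have hσ : ∀ v, Function.Injective (σ v) := fun v a b h => by
    simpa using (hτ v).injective h
  let point : V → (Fin (ℓ + 1) → Fin M) → V := fun v x =>
    S'.point (child v (σ v (x 0))) fun u => e v (σ v (x 0), u) (Fin.castLE hMm (x u.succ))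
  -- Two children of `v` are at distance at most 2 and joined in `(c v).2`; were this one of their
  -- common line colours, they would be linked.
  have hnew : ∀ i, ∀ v ∈ C i, (c v).2 ∉ Set.range (c v).1 := by
    rintro i v hv ⟨j, hj⟩
    have h01 : Fin.castSucc (0 : Fin (M + 2)) < Fin.castSucc 1 := by
      simp
    refine hS' _ _ (fun h => (hτ v h01).ne ?_) (c v).2
      (fun u => e v (τ v (Fin.castSucc 0), u)) (fun u => e v (τ v (Fin.castSucc 1), u))
      _ (hmem i v hv (τ v (Fin.castSucc 0))) _ (hmem i v hv (τ v (Fin.castSucc 1)))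
      ⟨?_, ⟨j, by rw [hcolour, hj]⟩, ⟨j, by rw [hcolour, hj]⟩, fun x y => ?_⟩
    · simpa using h
    · refine SimpleGraph.edist_triangle.trans (add_le_add (b := 1) (d := 1)
        (SimpleGraph.edist_eq_one_iff_adj.mpr (hadj i v hv _).symm).le
        (SimpleGraph.edist_eq_one_iff_adj.mpr (hadj i v hv _)).le) |>.trans ?_
      norm_num
    · rw [hpair v _ _ (hτ v h01).ne, hΓc v _ _ h01]
  refine ⟨{
    centers := C
    disj := fun i j hij => Finset.disjoint_left.mpr fun v hi hj => hij (hCuniq i j v hi hj)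
    le_card := hCcard
    point := point
    colour := fun v => Fin.cons (c v).2 (c v).1
    near := ?_
    inj := ?_
    colour_inj := ?_
    line := ?_ }⟩
  · intro i v hv x
    calc F.edist v (point v x) ≤ F.edist v (child v (σ v (x 0))) +
          F.edist (child v (σ v (x 0))) (point v x) := SimpleGraph.edist_triangle
      _ ≤ 1 + ℓ := add_le_add (SimpleGraph.edist_eq_one_iff_adj.mpr (hadj i v hv _)).le
          (S'.near _ _ (hmem i v hv _) _)
      _ = ((ℓ + 1 : ℕ) : ℕ∞) := by push_cast; rw [add_comm]
  · intro i j v hv w hw x y h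
    obtain ⟨h₁, h₂⟩ := S'.inj _ _ _ (hmem i v hv _) _ (hmem j w hw _) _ _ h
    obtain ⟨rfl, h₃⟩ := hinj i j v hv w hw _ _ h₁
    have h₀ := hσ v h₃
    refine ⟨rfl, funext fun u => ?_⟩
    cases u using Fin.cases with
    | zero => exact h₀
    | succ u =>
      have := congrFun h₂ u
      rw [h₀] at this
      simpa using this
  · intro i v hv
    rw [Fin.cons_injective_iff]
    refine ⟨hnew i v hv, ?_⟩
    rw [← hcolour v 0]
    exact S'.colour_inj _ _ (hmem i v hv _)
  · intro i v hv x j a b hab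
    cases j using Fin.cases with
    | zero =>
      have key : ∀ a b : Fin M, a < b →
          col (point v (Function.update x 0 a)) (point v (Function.update x 0 b)) = (c v).2 := by
        intro a b hab
        have hlt : a.castLE (by omega : M ≤ M + 3) < b.castLE (by omega) := hab
        have := hpair v (σ v a) (σ v b) (fun h => hab.ne (hσ v h))
          (fun u => Fin.castLE hMm (x u.succ)) (fun u => Fin.castLE hMm (x u.succ))
        rw [hΓc v _ _ hlt] at this
        simpa [point] using this
      rw [Fin.cons_zero]
      rcases lt_or_gt_of_ne hab with h | h
      · exact key a b h
      · rw [hsymm]; exact key b a h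
    | succ j =>
      have hupd : ∀ a : Fin M, point v (Function.update x j.succ a) =
          S'.point (child v (σ v (x 0))) (Function.update
            (fun u => e v (σ v (x 0), u) (Fin.castLE hMm (x u.succ))) j
            (e v (σ v (x 0), j) (Fin.castLE hMm a))) := by
        intro a
        have h0 : Function.update x j.succ a 0 = x 0 :=
          Function.update_of_ne (Fin.succ_ne_zero j).symm _ _
        simp only [point, h0]
        congr 1
        funext u
        by_cases huj : u = j
        · subst huj; simp
        · simp [huj]
      rw [hupd, hupd, S'.line _ _ (hmem i v hv _) _ _ _ _ (by simpa using hab), Fin.cons_succ]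
      exact congrFun (hcolour v (Fin.castLE (by omega) (x 0))) j

end ClusterSystem

/-- In dimension 0 a cluster is a single vertex, so only enough vertices are needed;
`ClusterSystem.exists_succ` does the rest. -/
theorem exists_clusterSystem (s K ℓ : ℕ) : ∀ (ι : Type) [Finite ι] (M c : ℕ),
    ∃ C : ℕ, ∀ {V : Type} [Fintype V] (F : SimpleGraph V)
      (col : V → V → Fin s) (n : ℕ) (_ : 2 ≤ n) (_ : C * n ≤ Fintype.card V)
      (_ : ∀ v w, col v w = col w v) (H : Fin s → SimpleGraph V) (R : ℕ) (_ : 2 * ℓ ≤ R)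
      (_ : ∀ v w, v ≠ w → F.edist v w ≤ R → (H (col v w)).Adj v w)
      (_ : ∀ γ, ¬ HasThickPath (H γ) n K)
      (_ : ∀ A B : Finset V, Disjoint A B → n ≤ A.card → n ≤ B.card →
        ∃ a ∈ A, ∃ b ∈ B, F.Adj a b),
      Nonempty (ClusterSystem F col ι ℓ M (c * n)) := by
  classical
  induction ℓ with
  | zero =>
    intro ι _ M c
    have := Fintype.ofFinite ι
    refine ⟨Fintype.card ι * c, fun {V} _ F col n _ hV _ _ _ _ _ _ _ => ?_⟩
    obtain ⟨g⟩ : Nonempty (ι × Fin (c * n) ↪ V) :=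
      Function.Embedding.nonempty_of_card_le (by simpa [mul_assoc] using hV)
    refine ⟨{
      centers := fun i => Finset.univ.image fun a => g (i, a)
      disj := fun i j hij => Finset.disjoint_left.mpr fun v hi hj => ?_
      le_card := fun i => ?_
      point := fun v _ => v
      colour := fun _ => nofun
      near := by simp
      inj := fun _ _ _ _ _ _ _ _ h => ⟨h, Subsingleton.elim _ _⟩
      colour_inj := fun _ _ _ j => j.elim0
      line := fun _ _ _ _ j => j.elim0 }⟩
    · obtain ⟨a, -, rfl⟩ := Finset.mem_image.mp hi
      obtain ⟨b, -, h⟩ := Finset.mem_image.mp hj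
      exact hij (congrArg Prod.fst (g.injective h)).symm
    · rw [Finset.card_image_of_injective _ fun a b h => congrArg Prod.snd (g.injective h)]
      simp
  | succ ℓ ih =>
    intro ι _ M c
    obtain ⟨ι', _, M', B, hB⟩ := ClusterSystem.exists_succ ι s ℓ M K
    obtain ⟨C, hC⟩ := ih ι' M' (B * (c + 1))
    refine ⟨C, fun {V} _ F col n hn hV hsymm H R hR hH hno hF => ?_⟩
    obtain ⟨S⟩ := hC F col n hn hV hsymm H R (by omega) hH hno hF
    rw [show B * (c + 1) * n = B * (c * n + n) by ring] at S
    exact hB F col n (c * n) S hn hsymm H R hR hH hno hF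

/-- Every colouring of a large power of a large expanding graph contains a monochromatic thick
path. -/
theorem exists_monochromatic_thickPath (s K : ℕ) : ∃ C : ℕ, 0 < C ∧ ∀ {V : Type} [Fintype V]
    (F : SimpleGraph V) (col : V → V → Fin s) (n : ℕ) (_ : 2 ≤ n) (_ : C * n ≤ Fintype.card V)
    (_ : ∀ v w, col v w = col w v) (H : Fin s → SimpleGraph V)
    (_ : ∀ v w, v ≠ w → F.edist v w ≤ (2 * (s + 1) : ℕ) → (H (col v w)).Adj v w)
    (_ : ∀ A B : Finset V, Disjoint A B → n ≤ A.card → n ≤ B.card →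
      ∃ a ∈ A, ∃ b ∈ B, F.Adj a b),
    ∃ γ, HasThickPath (H γ) n K := by
  obtain ⟨C, hC⟩ := exists_clusterSystem s K (s + 1) Unit 1 1
  refine ⟨C + 1, C.succ_pos, fun {V} _ F col n hn hV hsymm H hH hF => ?_⟩
  by_contra! hno
  obtain ⟨S⟩ := hC F col n hn ((Nat.mul_le_mul_right n C.le_succ).trans hV) hsymm H _ le_rfl hH
    hno hF
  obtain ⟨v, hv⟩ := Finset.card_pos.mp (lt_of_lt_of_le (by omega) (S.le_card ()))
  have := Fintype.card_le_of_injective _ (S.colour_inj () v hv)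
  simp at this

/-! ### Folding the cycle onto a path. -/

theorem cycleGraph_adj_min_le {n : ℕ} {u v : Fin n} (h : (SimpleGraph.cycleGraph n).Adj u v) :
    min (u : ℕ) (n - u) ≤ min (v : ℕ) (n - v) + 1 := by
  have key : ∀ a b : Fin n, (a - b).val = 1 → (a : ℕ) = b + 1 ∨ ((a : ℕ) = 0 ∧ (b : ℕ) + 1 = n) := by
    intro a b hab
    rcases le_or_gt b a with hle | hlt
    · rw [Fin.coe_sub_iff_le.mpr hle] at hab
      have : (b : ℕ) ≤ a := hle
      omega
    · rw [Fin.coe_sub_iff_lt.mpr hlt] at hab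
      have : (a : ℕ) < b := hlt
      omega
  rw [SimpleGraph.cycleGraph_adj'] at h
  rcases h with h | h
  · have := key _ _ h; omega
  · have := key _ _ h; omega

theorem min_le_of_cycleGraph_edist_le {n k : ℕ} {u v : Fin n}
    (h : (SimpleGraph.cycleGraph n).edist u v ≤ k) :
    min (u : ℕ) (n - u) ≤ min (v : ℕ) (n - v) + k := by
  obtain ⟨p, hp⟩ := SimpleGraph.exists_walk_of_edist_ne_top (ne_top_of_le_ne_top (by simp) h)
  have key : ∀ {u v : Fin n} (p : (SimpleGraph.cycleGraph n).Walk u v),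
      min (u : ℕ) (n - u) ≤ min (v : ℕ) (n - v) + p.length := by
    intro u v p
    induction p with
    | nil => simp
    | cons h p ih =>
      have := cycleGraph_adj_min_le h
      rw [SimpleGraph.Walk.length_cons]
      omega
  have hk : p.length ≤ k := by
    rw [← hp] at h
    exact_mod_cast h
  exact (key p).trans (by omega)

/-- The distance `D i` from vertex 0 is 1-Lipschitz, so cutting its values into intervals of length
`k` sends adjacent vertices of the power to equal or consecutive blocks. At most two vertices share
a value of `D`, one on each side of the cycle; the two halves of a block, of `k` slots each, keep
them apart. -/
theorem HasThickPath.cycle_power_isContained {V : Type} {H : SimpleGraph V} {n k : ℕ} (hk : 1 ≤ k)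
    (h : HasThickPath H n (2 * k)) : (graphPower (SimpleGraph.cycleGraph n) k).IsContained H := by
  obtain ⟨q, hinj, hin, hnext⟩ := h
  let D : Fin n → ℕ := fun i => min (i : ℕ) (n - i)
  have hblock : ∀ i, D i / k < n := fun i =>
    (Nat.div_le_self _ _).trans_lt ((min_le_left _ _).trans_lt i.2)
  have hslot : ∀ i : Fin n, D i % k + (if 2 * (i : ℕ) ≤ n then 0 else k) < 2 * k := fun i => by
    have := Nat.mod_lt (D i) hk
    split_ifs <;> omega
  let g : Fin n → V := fun i => q ⟨D i / k, hblock i⟩ ⟨_, hslot i⟩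
  have hg : Function.Injective g := by
    intro i j hij
    obtain ⟨h₁, h₂⟩ := hinj _ _ _ _ hij
    rw [Fin.mk.injEq] at h₁ h₂
    have hi := Nat.div_add_mod (D i) k
    have hj := Nat.div_add_mod (D j) k
    have hi' := Nat.mod_lt (D i) hk
    have hj' := Nat.mod_lt (D j) hk
    rw [h₁] at hi
    have hDi : D i = min (i : ℕ) (n - i) := rfl
    have hDj : D j = min (j : ℕ) (n - j) := rfl
    ext
    split_ifs at h₂ <;> omega
  refine ⟨⟨⟨g, fun {i j} hij => ?_⟩, hg⟩⟩
  have hne : g i ≠ g j := fun h => hij.1 (hg h)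
  have h₁ : D i / k ≤ D j / k + 1 := by
    rw [← Nat.add_div_right _ hk]
    exact Nat.div_le_div_right (min_le_of_cycleGraph_edist_le hij.2)
  have h₂ : D j / k ≤ D i / k + 1 := by
    rw [← Nat.add_div_right _ hk]
    exact Nat.div_le_div_right
      (min_le_of_cycleGraph_edist_le (by rw [SimpleGraph.edist_comm]; exact hij.2))
  rcases lt_trichotomy (D i / k) (D j / k) with h | h | h
  · exact hnext _ _ _ _ (by dsimp only; omega)
  · have hb : (⟨D i / k, hblock i⟩ : Fin n) = ⟨D j / k, hblock j⟩ := Fin.ext h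
    simp only [g, hb] at hne ⊢
    exact hin _ _ _ fun h => hne (by rw [h])
  · exact (hnext _ _ _ _ (by dsimp only; omega)).symm

/-! ### Edge count of the host graph and conclusion. -/

theorem exists_ball_cover {V : Type} (F : SimpleGraph V) (d : ℕ)
    (hF : ∀ v, ∃ N : Finset V, N.card ≤ d ∧ ∀ w, F.Adj v w → w ∈ N) (R : ℕ) (v : V) :
    ∃ N : Finset V, N.card ≤ (d + 1) ^ R ∧ ∀ w, F.edist v w ≤ R → w ∈ N := by
  classical
  induction R generalizing v with
  | zero => exact ⟨{v}, by simp, fun w hw => by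
    rw [Finset.mem_singleton, eq_comm]
    exact SimpleGraph.edist_eq_zero_iff.mp (nonpos_iff_eq_zero.mp (by exact_mod_cast hw))⟩
  | succ R ih =>
    choose N hN hmem using ih
    obtain ⟨N₁, hN₁, hmem₁⟩ := hF v
    refine ⟨(insert v N₁).biUnion N, ?_, fun w hw => ?_⟩
    · refine (Finset.card_biUnion_le_card_mul _ _ _ fun u _ => hN u).trans ?_
      rw [pow_succ']
      exact Nat.mul_le_mul_right _ ((Finset.card_insert_le _ _).trans (by omega))
    · obtain ⟨p, hp⟩ := SimpleGraph.exists_walk_of_edist_ne_top (ne_top_of_le_ne_top (by simp) hw)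
      rw [← hp] at hw
      have hw' : p.length ≤ R + 1 := by exact_mod_cast hw
      cases p with
      | nil => exact Finset.mem_biUnion.mpr ⟨v, by simp, hmem v v (by simp)⟩
      | @cons _ u _ h p =>
        rw [SimpleGraph.Walk.length_cons] at hw'
        refine Finset.mem_biUnion.mpr ⟨u, Finset.mem_insert_of_mem (hmem₁ u h), hmem u w ?_⟩
        exact (SimpleGraph.edist_le p).trans (by exact_mod_cast (by omega : p.length ≤ R))

theorem encard_edgeSet_graphPower_le {N : ℕ} (F : SimpleGraph (Fin N)) (d : ℕ)
    (hF : ∀ v, ∃ N : Finset (Fin N), N.card ≤ d ∧ ∀ w, F.Adj v w → w ∈ N) (R : ℕ) :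
    (graphPower F R).edgeSet.encard ≤ ((N * (d + 1) ^ R : ℕ) : ℕ∞) := by
  classical
  choose B hB hmem using exists_ball_cover F d hF R
  let E : Finset (Sym2 (Fin N)) := Finset.univ.biUnion fun v => (B v).image fun w => s(v, w)
  have hE : (graphPower F R).edgeSet ⊆ E := by
    intro e he
    induction e using Sym2.inductionOn with
    | hf v w =>
      rw [SimpleGraph.mem_edgeSet] at he
      exact Finset.mem_coe.mpr (Finset.mem_biUnion.mpr
        ⟨v, Finset.mem_univ _, Finset.mem_image.mpr ⟨w, hmem v w he.2, rfl⟩⟩)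
  refine (Set.encard_le_encard hE).trans ?_
  rw [Set.encard_coe_eq_coe_finsetCard]
  refine Nat.cast_le.mpr ((Finset.card_biUnion_le_card_mul _ _ ((d + 1) ^ R)
    fun v _ => Finset.card_image_le.trans (hB v)).trans ?_)
  simp

theorem mainTheorem2 (s k : ℕ) (hs : 1 ≤ s) (hk : 1 ≤ k) :
    ∃ C : ℕ, ∀ n : ℕ, 3 ≤ n →
      sizeRamsey s (graphPower (SimpleGraph.cycleGraph n) k) ≤ (C : ℕ∞) * (n : ℕ∞) := by
  classical
  obtain ⟨C, hC, hpath⟩ := exists_monochromatic_thickPath s (2 * k)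
  obtain ⟨d, hd⟩ := exists_bounded_degree_expander C hC
  refine ⟨C * (d + 1) ^ (2 * (s + 1)), fun n hn => ?_⟩
  obtain ⟨F, hdeg, hexp⟩ := hd n (by omega)
  set R := 2 * (s + 1) with hR
  have hramsey : IsRamseyFor s (graphPower F R) (graphPower (SimpleGraph.cycleGraph n) k) := by
    intro χ
    -- The default colour of non-edges is harmless: the graphs `χ.labelGraph` are only claimed to
    -- contain pairs within distance `R`.
    let col : Fin (C * n) → Fin (C * n) → Fin s := fun v w =>
      if h : (graphPower F R).Adj v w then χ.get v w h else ⟨0, hs⟩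
    obtain ⟨γ, hγ⟩ := hpath F col n (by omega) (by simp) (fun v w => by
        by_cases h : (graphPower F R).Adj v w
        · simp only [col, h, h.symm, dite_true]
          exact χ.get_comm w v _
        · have h' : ¬ (graphPower F R).Adj w v := fun h' => h h'.symm
          simp only [col, h, h', dite_false])
      χ.labelGraph (fun v w hne hdist => by
        have h : (graphPower F R).Adj v w := ⟨hne, hdist⟩
        rw [SimpleGraph.EdgeLabeling.labelGraph_adj]
        refine ⟨h, ?_⟩
        simp only [col, h, dite_true]
        rfl) hexp
    exact ⟨γ, hγ.cycle_power_isContained hk⟩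
  refine (iInf_le_of_le (C * n) (iInf_le_of_le (graphPower F R) (iInf_le _ hramsey))).trans ?_
  refine (encard_edgeSet_graphPower_le F d hdeg R).trans (le_of_eq ?_)
  push_cast
  ring
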